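/- Notation. Let $d$ be a natural number. For $f:[0,1]^d\to\mathbb R$ and $a\le b$ in $[0,1]^d$ put $f((a,b])=\sum_{I\subset\{1,\dots,d\}}(-1)^{|I|}f(a_I:b_{-I})$, where $a_I:b_{-I}$ has coordinates $a_j$ for $j\in I$ and $b_j$ for $j\notin I$. A ladder is a product $\mathcal Y=\prod_{i=1}^d\mathcal Y_i$, where each $\mathcal Y_i$ consists of $0$ and finitely many (possibly no) points of $(0,1)$; the successor $y^+$ of $y\in\mathcal Y$ has $i$-th coordinate the smallest element of $\mathcal Y_i$ larger than $y_i$, or $1$ if there is none. The Vitali variation of $f$ is $V(f)=\sup_{\mathcal Y}\sum_{y\in\mathcal Y}|f((y,y^+])|$, and the Hardy–Krause variation of $f$ is $V_{HK}(f)=\sum_{I\subset\{1,\dots,d\}}V(f(\cdot\,;1_{-I}))$, where $f(\cdot\,;1_{-I})$ is the function on $[0,1]^I$ obtained from $f$ by fixing all coordinates outside $I$ at $1$; the term for $I=\emptyset$ is $|f(1,\dots,1)|$. Say that $f$ satisfies Assumption F if it is coordinatewise right-continuous (in each coordinate, at every point) and $V_{HK}(f)<\infty$. To a function $g$ satisfying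 Assumption F belongs the unique signed Borel measure on $[0,1]^d$ that assigns mass $g(x)$ to $[0,x]$ for all $x\in[0,1]^d$, and $\int f\,dg$ denotes the integral of $f$ with respect to this measure. Weak convergence in $\ell^\infty(S)$ (the bounded real functions on $S$ with the supremum norm) is meant in the sense of Hoffmann-Jørgensen: processes $X_n=(X_n(s))_{s\in S}$, defined on probability spaces that may depend on $n$ and with almost surely bounded sample paths, converge weakly to a Borel probability law $L$ on $\ell^\infty(S)$ if $E^*H(X_n)\to\int H\,dL$ for every bounded continuous $H:\ell^\infty(S)\to\mathbb R$, where $E^*$ is outer expectation. The limit is a Gaussian process if the coordinates $z\mapsto z(s)$, $s\in S$, have jointly Gaussian finite-dimensional distributions under $L$. Theorem. For each $n$ let $\mathbb G_n=(\mathbb G_n(u))_{u\in[0,1]^d}$ be a stochastic process whose sample paths almost surely satisfy Assumption F, and such that, for every $u\in[0,1]^d$ with $u_j=0$ for some $j$, $\mathbb G_n(u)=0$ almost surely. Suppose that $\mathbb G_n$ converges weakly in $\ell^\infty([0,1]^d)$ to a Gaussian process $\mathbb G$ with almost surely continuous sample paths. Let $T<\infty$ and let $\mathcal F$ be any class of functions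 $f:[0,1]^d\to\mathbb R$ satisfying Assumption F with $V_{HK}(f)\le T$. Then, for every $n$, almost surely the signed measure belonging to $\mathbb G_n$ exists and every $f\in\mathcal F$ is integrable with respect to it, and the process $\left(\int f\,d\mathbb G_n\right)_{f\in\mathcal F}$ converges weakly in $\ell^\infty(\mathcal F)$ to a tight Gaussian process. -/

import Mathlib

open MeasureTheory ProbabilityTheory Filter Topology
open scoped NNReal ENNReal

noncomputable section

namespace HardyKrause

/-! ### Functions of bounded Hardy-Krause variation on the unit cube -/

/-- The closed unit cube `[0,1]^ι`, with the product topology, the product order (so that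
`Set.Iic x` is the box `[0,x]`) and the product (Borel) σ-algebra. -/
abbrev Cube (ι : Type*) : Type _ := ι → unitInterval

section Variation

variable {ι : Type*} [Fintype ι] [DecidableEq ι]

/-- The generalized volume `∑_{I} (-1)^{|I|} f(a_I : b_{-I})` that `f` assigns to the half-open
box `(a,b]`. -/
def boxIncrement (f : Cube ι → ℝ) (a b : Cube ι) : ℝ :=
  ∑ I : Finset ι, (-1) ^ I.card * f (I.piecewise a b)

/-- The successor of `y` with respect to the finite set `Y`: the smallest element of `Y` that is
strictly larger than `y`, and `1` if there is none. -/
def successor (Y : Finset unitInterval) (y : unitInterval) : unitInterval :=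
  (Y.filter (fun z => y < z)).inf id

/-- A multivariate ladder: in each coordinate a finite set which consists of `0` and of finitely
many (possibly no) points of the open interval `(0,1)`. -/
def IsLadder (Y : ι → Finset unitInterval) : Prop :=
  ∀ i, 0 ∈ Y i ∧ 1 ∉ Y i

/-- The variation of `f` over the multivariate ladder `∏ i, Y i`. -/
def ladderVariation (f : Cube ι → ℝ) (Y : ι → Finset unitInterval) : ℝ :=
  ∑ y ∈ Fintype.piFinset Y, |boxIncrement f y (fun i => successor (Y i) (y i))|

/-- The total variation in the sense of Vitali. -/
def vitaliVariation (f : Cube ι → ℝ) : ℝ≥0∞ :=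
  ⨆ (Y : ι → Finset unitInterval) (_ : IsLadder Y), ENNReal.ofReal (ladderVariation f Y)

/-- The lower-dimensional projection `x_I ↦ f(x_I : 1_{-I})`. -/
def projOne (f : Cube ι → ℝ) (I : Finset ι) : Cube {i // i ∈ I} → ℝ :=
  fun x => f (fun i => if h : i ∈ I then x ⟨i, h⟩ else 1)

/-- The total variation in the sense of Hardy and Krause, including the term `|f(1,…,1)|`
that corresponds to the empty set of coordinates. -/
def hardyKrauseVariation (f : Cube ι → ℝ) : ℝ≥0∞ :=
  ∑ I : Finset ι, vitaliVariation (projOne f I)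

/-- Coordinatewise right-continuity, in each coordinate and at every point. -/
def RightContinuous (f : Cube ι → ℝ) : Prop :=
  ∀ (x : Cube ι) (j : ι),
    ContinuousWithinAt (fun t : unitInterval => f (Function.update x j t)) (Set.Ici (x j)) (x j)

/-- `f` is right-continuous and of bounded Hardy-Krause variation. -/
structure IsRCBoundedHK (f : Cube ι → ℝ) : Prop where
  rightContinuous : RightContinuous f
  variation_lt_top : hardyKrauseVariation f < ∞

end Variation

/-! ### The signed measure of a right-continuous function of bounded Hardy-Krause variation -/

section Measure

variable {ι : Type*}

/-- `ν` is a signed Borel measure on the cube with `ν([0,x]) = g(x)` for all `x`. -/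
def IsMeasureOf (g : Cube ι → ℝ) (ν : SignedMeasure (Cube ι)) : Prop :=
  ∀ x, ν (Set.Iic x) = g x

/-- There is at most one such signed measure. -/
theorem IsMeasureOf.unique [Finite ι] {g : Cube ι → ℝ} {ν ν' : SignedMeasure (Cube ι)}
    (h : IsMeasureOf g ν) (h' : IsMeasureOf g ν') : ν = ν' := by
  classical
  refine VectorMeasure.ext_of_generateFrom (Set.range (Set.Iic : Cube ι → Set (Cube ι)))
    ?_ ?_ ?_ ?_
  · rintro _ ⟨x, rfl⟩
    rw [h x, h' x]
  · refine le_antisymm ?_ ?_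
    · refine iSup_le fun i => ?_
      rw [← measurable_iff_comap_le]
      let _ : MeasurableSpace (Cube ι) :=
        MeasurableSpace.generateFrom (Set.range (Set.Iic : Cube ι → Set (Cube ι)))
      refine measurable_of_Iic fun t => ?_
      refine MeasurableSpace.measurableSet_generateFrom ⟨Function.update ⊤ i t, ?_⟩
      ext x
      simp only [Set.mem_Iic, Set.mem_preimage, Pi.le_def]
      constructor
      · intro hx
        simpa using hx i
      · intro hx j
        by_cases hj : j = i
        · subst hj
          simpa using hx
        · simp [hj]
    · refine MeasurableSpace.generateFrom_le ?_
      rintro _ ⟨x, rfl⟩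
      exact measurableSet_Iic
  · rintro _ ⟨x, rfl⟩ _ ⟨y, rfl⟩ _
    exact ⟨x ⊓ y, by rw [Set.Iic_inter_Iic]⟩
  · have hu : (Set.univ : Set (Cube ι)) = Set.Iic ⊤ := Set.Iic_top.symm
    rw [hu, h ⊤, h' ⊤]

open Classical in
/-- The unique signed Borel measure `ν` on the cube with `ν([0,x]) = g(x)` for all `x`
(and `0` if no such measure exists). -/
def measureOf (g : Cube ι → ℝ) : SignedMeasure (Cube ι) :=
  if h : ∃ ν, IsMeasureOf g ν then h.choose else 0

/-- The Lebesgue-Stieltjes integral `∫ f dg` over the cube. -/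
def stieltjesIntegral (f g : Cube ι → ℝ) : ℝ :=
  (measureOf g).integral f (ContinuousLinearMap.lsmul ℝ ℝ)

end Measure

/-! ### Weak convergence in `ℓ^∞(S)` -/

/-- The Banach space `ℓ^∞(S)` of bounded real functions on `S`, with the supremum norm. -/
abbrev LInf (S : Type*) : Type _ := lp (fun _ : S => ℝ) ∞

/-- `ℓ^∞(S)` carries its Borel σ-algebra. -/
instance instMeasurableSpaceLInf (S : Type*) : MeasurableSpace (LInf S) := borel _

instance instBorelSpaceLInf (S : Type*) : BorelSpace (LInf S) := ⟨rfl⟩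

open Classical in
/-- A bounded real function on `S` as an element of `ℓ^∞(S)` (and `0` if it is unbounded). -/
def toLInf {S : Type*} (g : S → ℝ) : LInf S :=
  if h : Memℓp g ∞ then ⟨g, h⟩ else 0

/-- The outer expectation `E^* X` of a bounded, not necessarily measurable `X`: the infimum of
`E U` over all measurable integrable `U ≥ X`. -/
def outerExpectation {Ω : Type*} [MeasurableSpace Ω] (P : Measure Ω) (X : Ω → ℝ) : ℝ :=
  sInf {r : ℝ | ∃ U : Ω → ℝ, Measurable U ∧ Integrable U P ∧ (∀ ω, X ω ≤ U ω) ∧ r = ∫ ω, U ω ∂P}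

/-- The processes `X n = (X n ω s)_{s ∈ S}`, defined on the probability spaces `(Ω n, P n)`, have
almost surely bounded sample paths and converge weakly in `ℓ^∞(S)` (in the sense of
Hoffmann-Jørgensen) to the Borel law `L`: `E^* H(X n) → ∫ H dL` for each bounded continuous
`H : ℓ^∞(S) → ℝ`. -/
structure ConvergesWeakly {Ω : ℕ → Type*} [∀ n, MeasurableSpace (Ω n)]
    (P : ∀ n, Measure (Ω n)) {S : Type*} (X : ∀ n, Ω n → S → ℝ) (L : Measure (LInf S)) :
    Prop where
  bounded : ∀ n, ∀ᵐ ω ∂P n, Memℓp (X n ω) ∞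
  tendsto : ∀ H : BoundedContinuousFunction (LInf S) ℝ,
    Tendsto (fun n => outerExpectation (P n) (fun ω => H (toLInf (X n ω)))) atTop
      (𝓝 (∫ z, H z ∂L))

/-- The Borel law `L` on `ℓ^∞(S)` is the law of a Gaussian process indexed by `S`: the coordinate
process has Gaussian finite-dimensional distributions. -/
def IsGaussianLaw {S : Type*} (L : Measure (LInf S)) : Prop :=
  IsGaussianProcess (fun (s : S) (z : LInf S) => z s) L

end HardyKrause

end

open HardyKrause

/-!
# Integrals of functions of bounded Hardy-Krause variation against weakly convergent processes

The integral `∫ f dg`, as a functional of the integrator `g`, is bounded with respect to the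
supremum norm: `|∫ f dg| ≤ V_HK(f) ‖g‖_∞` (`IsRCBoundedHK.abs_integral_le`), whatever the variation
of `g` is. This comes from summation by parts. On a grid, `f` rounded up to the grid is a combination
of indicators of boxes `[0,y]` whose coefficients are the increments of `f` and of its face
functions `f(·; 1_{-I})` over the cells (`stepSum_eq`). The integral of the indicator of `[0,y]`
is `g(y)`, so the integral of this step function is at most `V_HK(f) ‖g‖_∞`; refining the grid, the
step functions converge pointwise to `f`.

The distribution functions of signed measures form a subspace of `ℓ^∞([0,1]^d)`. By the Hahn-Banach
theorem, applied for each `f` separately, `g ↦ (∫ f dg)_{f ∈ F}` is the restriction to it of a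
continuous linear operator `Φ : ℓ^∞([0,1]^d) → ℓ^∞(F)` (`exists_integration_operator`). The process
of integrals is almost surely `Φ(G_n)`, and it converges weakly to the image of the limit law under
`Φ` by the continuous mapping theorem (`ConvergesWeakly.map`). The limit law is carried by the
continuous functions. They form a Polish space, whence tightness; and on them `Φ` is a limit of
finite linear combinations of point evaluations, whence the image is Gaussian
(`IsGaussianLaw.map`), an almost sure limit of Gaussian variables being Gaussian.

That a right-continuous function of bounded Hardy-Krause variation is the distribution function of a
signed measure (`IsRCBoundedHK.exists_isMeasureOf`) also follows from summation by parts: on every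
finite set of points, `f` agrees with the distribution function of a signed combination of point
masses of total mass at most `2^d V_HK(f)`. The positive and the negative parts converge
weakly along an ultrafilter by Prokhorov's theorem, and right-continuity of `f` identifies the limit.
-/

noncomputable section

namespace HardyKrause

/-! ### Summation by parts on a grid -/

section Grid

/-- The smallest element of `Y ∪ {1}` that is at least `t`. -/
def roundUp (Y : Finset unitInterval) (t : unitInterval) : unitInterval :=
  (Y.filter (fun z => t ≤ z)).inf id

/-- Telescoping of the increments over consecutive points of a finite set. -/
lemma sum_successor_sub (S : Finset unitInterval) (h : unitInterval → ℝ) :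
    ∑ y ∈ S, (h (successor S y) - h y) = h 1 - h (S.inf id) := by
  induction S using Finset.induction_on_min with
  | empty => simp [show (⊤ : unitInterval) = 1 from rfl]
  | insert a s ha ih =>
    have has : a ∉ s := fun hm => lt_irrefl _ (ha a hm)
    rw [Finset.sum_insert has]
    have h1 : successor (insert a s) a = s.inf id := by
      unfold successor
      rw [Finset.filter_insert, if_neg (lt_irrefl a), Finset.filter_true_of_mem ha]
    have h2 : ∀ y ∈ s, h (successor (insert a s) y) - h y = h (successor s y) - h y := by
      intro y hy
      unfold successor
      rw [Finset.filter_insert, if_neg (ha y hy).not_gt]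
    rw [Finset.sum_congr rfl h2, ih, h1, Finset.inf_insert]
    have h3 : id a ⊓ s.inf id = a := inf_eq_left.2 (Finset.le_inf fun b hb => (ha b hb).le)
    rw [h3]
    ring

lemma sum_successor_sub_of_le (Y : Finset unitInterval) (h : unitInterval → ℝ)
    (t : unitInterval) :
    ∑ y ∈ Y, (if t ≤ y then h (successor Y y) - h y else 0) = h 1 - h (roundUp Y t) := by
  rw [← Finset.sum_filter, roundUp, ← sum_successor_sub]
  refine Finset.sum_congr rfl fun y hy => ?_
  have : successor (Y.filter (fun z => t ≤ z)) y = successor Y y := by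
    unfold successor
    rw [Finset.filter_filter]
    congr 1
    ext z
    simp only [Finset.mem_filter, and_congr_right_iff, and_iff_right_iff_imp]
    exact fun _ hz => (Finset.mem_filter.1 hy).2.trans hz.le
  rw [this]

lemma inf_id_mem (S : Finset unitInterval) : S.inf id = 1 ∨ S.inf id ∈ S := by
  rcases S.eq_empty_or_nonempty with rfl | hS
  · left; simp; rfl
  · right
    obtain ⟨a, ha, h⟩ := Finset.exists_mem_eq_inf S hS id
    rw [h]; exact ha

lemma successor_mem (Y : Finset unitInterval) (y : unitInterval) :
    successor Y y = 1 ∨ successor Y y ∈ Y :=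
  (inf_id_mem _).imp_right fun h => Finset.filter_subset _ _ h

lemma roundUp_mem (Y : Finset unitInterval) (y : unitInterval) :
    roundUp Y y = 1 ∨ roundUp Y y ∈ Y :=
  (inf_id_mem _).imp_right fun h => Finset.filter_subset _ _ h

lemma le_roundUp (Y : Finset unitInterval) (t : unitInterval) : t ≤ roundUp Y t :=
  Finset.le_inf fun _ hb => (Finset.mem_filter.1 hb).2

lemma roundUp_le {Y : Finset unitInterval} {t y : unitInterval} (hy : y ∈ Y) (h : t ≤ y) :
    roundUp Y t ≤ y :=
  Finset.inf_le (f := id) (Finset.mem_filter.2 ⟨hy, h⟩)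

lemma roundUp_eq_self {Y : Finset unitInterval} {t : unitInterval} (h : t = 1 ∨ t ∈ Y) :
    roundUp Y t = t := by
  refine le_antisymm ?_ (le_roundUp Y t)
  rcases h with rfl | h
  · exact unitInterval.le_one'
  · exact roundUp_le h le_rfl

/-- For a grid point `x` (or `x = 1`) the closed condition `x ≤ y` on grid points `y` is the open
condition `x < y⁺`. -/
lemma lt_successor_iff {Y : Finset unitInterval} (hY : 1 ∉ Y) {x y : unitInterval} (hy : y ∈ Y)
    (hx : x = 1 ∨ x ∈ Y) : x < successor Y y ↔ x ≤ y := by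
  have hy1 : y < 1 := lt_of_le_of_ne unitInterval.le_one' fun h => hY (h ▸ hy)
  constructor
  · intro h
    by_contra! hlt
    rcases hx with rfl | hx
    · exact absurd unitInterval.le_one' h.not_ge
    · exact absurd (Finset.inf_le (f := id) (Finset.mem_filter.2 ⟨hx, hlt⟩)) h.not_ge
  · intro h
    refine h.trans_lt ?_
    refine (Finset.lt_inf_iff ?_).2 fun b hb => (Finset.mem_filter.1 hb).2
    exact hy1

end Grid

section StepSum

variable {ι : Type*} [Fintype ι] [DecidableEq ι]

lemma boxIncrement_congr {f g : Cube ι → ℝ} {a b : Cube ι}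
    (h : ∀ I : Finset ι, f (I.piecewise a b) = g (I.piecewise a b)) :
    boxIncrement f a b = boxIncrement g a b := by
  simp only [boxIncrement, h]

lemma boxIncrement_sum_mul {α : Type*} (s : Finset α) (c : α → ℝ) (f : α → Cube ι → ℝ)
    (a b : Cube ι) :
    boxIncrement (fun x => ∑ k ∈ s, c k * f k x) a b = ∑ k ∈ s, c k * boxIncrement (f k) a b := by
  simp only [boxIncrement, Finset.mul_sum]
  rw [Finset.sum_comm]
  refine Finset.sum_congr rfl fun k _ => Finset.sum_congr rfl fun I _ => by ring

lemma boxIncrement_const_mul (c : ℝ) (f : Cube ι → ℝ) (a b : Cube ι) :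
    boxIncrement (fun x => c * f x) a b = c * boxIncrement f a b := by
  simp only [boxIncrement, Finset.mul_sum]
  exact Finset.sum_congr rfl fun I _ => by ring

lemma boxIncrement_prod (h : ι → unitInterval → ℝ) (a b : Cube ι) :
    boxIncrement (fun x => ∏ i, h i (x i)) a b = ∏ i, (h i (b i) - h i (a i)) := by
  rw [Finset.prod_sub, boxIncrement]
  rw [Finset.powerset_univ]
  refine Finset.sum_congr rfl fun I _ => ?_
  have : ∏ i, h i (I.piecewise a b i) = (∏ i ∈ Finset.univ \ I, h i (b i)) * ∏ i ∈ I, h i (a i) := by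
    rw [← Finset.prod_sdiff (Finset.subset_univ I)]
    congr 1
    · refine Finset.prod_congr rfl fun i hi => ?_
      rw [Finset.piecewise_eq_of_notMem _ _ _ (Finset.mem_sdiff.1 hi).2]
    · refine Finset.prod_congr rfl fun i hi => ?_
      rw [Finset.piecewise_eq_of_mem _ _ _ hi]
  rw [this]; ring

/-- The increment of the face function `f(·; 1_{-I})` over the grid cell `(y, y⁺]`. -/
def cellIncrement (f : Cube ι → ℝ) (Y : ι → Finset unitInterval) (I : Finset ι)
    (y : Cube {i // i ∈ I}) : ℝ :=
  boxIncrement (projOne f I) y (fun i => successor (Y i) (y i))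

/-- The alternating sum over the faces `I` of the increments of `f(·; 1_{-I})` over all grid cells
`(y, y⁺]` with `x_I ≤ y`. As a function of `x` it is a combination of indicators of boxes
`[0, (y; 1_{-I})]`. -/
def stepSum (f : Cube ι → ℝ) (Y : ι → Finset unitInterval) (x : Cube ι) : ℝ :=
  ∑ I : Finset ι, (-1) ^ I.card * ∑ y ∈ Fintype.piFinset (fun i : {i // i ∈ I} => Y i),
    if ∀ i : {i // i ∈ I}, x i ≤ y i then cellIncrement f Y I y else 0

lemma projOne_prod (h : ι → unitInterval → ℝ) (I : Finset ι) (x : Cube {i // i ∈ I}) :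
    projOne (fun x => ∏ i, h i (x i)) I x
      = (∏ i ∈ Finset.univ \ I, h i 1) * ∏ i : {i // i ∈ I}, h i (x i) := by
  unfold projOne
  beta_reduce
  rw [← Finset.prod_sdiff (Finset.subset_univ I)]
  congr 1
  · refine Finset.prod_congr rfl fun i hi => ?_
    rw [dif_neg (Finset.mem_sdiff.1 hi).2]
  · rw [← Finset.prod_coe_sort I]
    refine Finset.prod_congr rfl fun i _ => ?_
    rw [dif_pos i.2]

lemma stepSum_prod (h : ι → unitInterval → ℝ) (Y : ι → Finset unitInterval) (x : Cube ι) :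
    stepSum (fun x => ∏ i, h i (x i)) Y x = ∏ i, h i (roundUp (Y i) (x i)) := by
  -- The telescoping sum in each coordinate; expanding the product gives the sum over the faces.
  have key : ∀ i, h i (roundUp (Y i) (x i)) = h i 1 -
      ∑ y ∈ Y i, (if x i ≤ y then h i (successor (Y i) y) - h i y else 0) := by
    intro i; rw [sum_successor_sub_of_le]; ring
  rw [Finset.prod_congr rfl fun i _ => key i, Finset.prod_sub, Finset.powerset_univ, stepSum]
  refine Finset.sum_congr rfl fun I _ => ?_
  rw [mul_assoc]
  congr 1
  rw [← Finset.prod_coe_sort I, Finset.prod_univ_sum, Finset.mul_sum]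
  refine Finset.sum_congr rfl fun y _ => ?_
  rw [Finset.prod_ite_zero]
  simp only [Finset.mem_univ, true_imp_iff, mul_ite, mul_zero]
  congr 1
  unfold cellIncrement
  rw [show projOne (fun x => ∏ i, h i (x i)) I = _ from funext (projOne_prod h I),
    boxIncrement_const_mul, boxIncrement_prod (fun i : {i // i ∈ I} => h i)]

/-- **Summation by parts.** The sum of the increments of `f` over the upper right orthants of `x`
recovers the value of `f` at `x` rounded up to the grid. Both sides are linear in `f` and only
involve its values on the grid, so that it suffices to consider products of functions of one
variable, where both sides factor. -/
lemma stepSum_eq (f : Cube ι → ℝ) (Y : ι → Finset unitInterval) (x : Cube ι) :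
    stepSum f Y x = f (fun i => roundUp (Y i) (x i)) := by
  -- `g` is a combination of products of functions of one variable and agrees with `f` on the
  -- grid points `Z`, at which alone both sides are evaluated.
  set Z : Finset (Cube ι) := Fintype.piFinset (fun i => insert 1 (Y i))
  set δ : Cube ι → Cube ι → ℝ := fun z x => ∏ i, (if x i = z i then 1 else 0) with hδ
  have hδ' : ∀ z x, δ z x = if x = z then 1 else 0 := by
    intro z x
    rw [hδ]
    simp only [Finset.prod_ite_zero, Finset.prod_const_one, Finset.mem_univ, true_imp_iff,
      funext_iff]
  set g : Cube ι → ℝ := fun x => ∑ z ∈ Z, f z * δ z x with hg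
  have hfg : ∀ z ∈ Z, f z = g z := by
    intro z hz
    simp [hg, hδ', hz]
  have h1 : stepSum f Y x = stepSum g Y x := by
    unfold stepSum
    refine Finset.sum_congr rfl fun I _ => ?_
    congr 1
    refine Finset.sum_congr rfl fun y hy => ?_
    congr 1
    refine boxIncrement_congr fun J => hfg _ ?_
    rw [Fintype.mem_piFinset] at hy ⊢
    intro i
    by_cases hi : i ∈ I
    · rw [dif_pos hi]
      by_cases hj : (⟨i, hi⟩ : {i // i ∈ I}) ∈ J
      · rw [Finset.piecewise_eq_of_mem _ _ _ hj]
        exact Finset.mem_insert_of_mem (hy ⟨i, hi⟩)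
      · rw [Finset.piecewise_eq_of_notMem _ _ _ hj]
        exact Finset.mem_insert.2 (successor_mem _ _)
    · rw [dif_neg hi]; exact Finset.mem_insert_self _ _
  have h2 : stepSum g Y x = ∑ z ∈ Z, f z * stepSum (δ z) Y x := by
    simp only [stepSum, cellIncrement, Finset.mul_sum]
    rw [Finset.sum_comm]
    refine Finset.sum_congr rfl fun I _ => ?_
    rw [Finset.sum_comm]
    refine Finset.sum_congr rfl fun y _ => ?_
    split_ifs with hc
    · rw [show projOne g I = fun x => ∑ z ∈ Z, f z * projOne (δ z) I x from rfl,
        boxIncrement_sum_mul, Finset.mul_sum]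
      exact Finset.sum_congr rfl fun z _ => by ring
    · simp
  rw [h1, h2, hfg _ (Fintype.mem_piFinset.2 fun i => Finset.mem_insert.2 (roundUp_mem _ _))]
  refine Finset.sum_congr rfl fun z _ => ?_
  rw [hδ, stepSum_prod (fun i t => if t = z i then 1 else 0)]

end StepSum

/-! ### Existence of the signed measure -/

section Limits

lemma IsMeasureOf.abs_le {ι : Type*} {g : Cube ι → ℝ} {ν : SignedMeasure (Cube ι)} (h : IsMeasureOf g ν)
    (x : Cube ι) : |g x| ≤ ν.totalVariation.real Set.univ := by
  rw [← h x, ← Real.norm_eq_abs]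
  exact (ν.norm_le_totalVariation _).trans (measureReal_mono (Set.subset_univ _))

variable {ι : Type*} [Fintype ι]

/-- Distribution functions of finite measures are jointly right-continuous. -/
lemma tendsto_real_Iic (μ : Measure (Cube ι)) [IsFiniteMeasure μ] {α : Type*} {l : Filter α}
    [l.IsCountablyGenerated] {u : α → Cube ι} {x : Cube ι} (hu : Tendsto u l (𝓝 x))
    (hx : ∀ᶠ k in l, x ≤ u k) :
    Tendsto (fun k => μ.real (Set.Iic (u k))) l (𝓝 (μ.real (Set.Iic x))) := by
  have h := tendsto_measure_of_tendsto_indicator_of_isFiniteMeasure l μ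
    (As := fun k => Set.Iic (u k)) (A := Set.Iic x) (fun _ => measurableSet_Iic) (fun z => ?_)
  · exact (ENNReal.tendsto_toReal (measure_ne_top _ _)).comp h
  · by_cases hz : z ≤ x
    · filter_upwards [hx] with k hk
      exact iff_of_true (hz.trans hk) hz
    · obtain ⟨i, hi⟩ : ∃ i, x i < z i := by simpa [Pi.le_def] using hz
      filter_upwards [((continuous_apply i).continuousAt.tendsto.comp hu).eventually_lt_const hi]
        with k hk
      exact iff_of_false (fun h => absurd (h i) hk.not_ge) hz

lemma IsMeasureOf.eq_sub {g : Cube ι → ℝ} {ν : SignedMeasure (Cube ι)} (h : IsMeasureOf g ν)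
    (x : Cube ι) : g x = ν.toJordanDecomposition.posPart.real (Set.Iic x)
      - ν.toJordanDecomposition.negPart.real (Set.Iic x) := by
  rw [← h x, ν.apply_eq_posPart_real_sub_negPart_real measurableSet_Iic]

/-- Distribution functions of signed measures are jointly right-continuous. -/
lemma IsMeasureOf.tendsto {g : Cube ι → ℝ} {ν : SignedMeasure (Cube ι)} (h : IsMeasureOf g ν)
    {α : Type*} {l : Filter α} [l.IsCountablyGenerated] {u : α → Cube ι} {x : Cube ι}
    (hu : Tendsto u l (𝓝 x)) (hx : ∀ᶠ k in l, x ≤ u k) :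
    Tendsto (fun k => g (u k)) l (𝓝 (g x)) := by
  simp only [h.eq_sub]
  exact (tendsto_real_Iic _ hu hx).sub (tendsto_real_Iic _ hu hx)

lemma exists_continuous_between_Iic {a b : Cube ι} (h : ∀ i, a i < b i ∨ b i = 1) :
    ∃ φ : C(Cube ι, ℝ), (∀ z, φ z ∈ Set.Icc (0 : ℝ) 1) ∧ (∀ z ≤ a, φ z = 1) ∧
      ∀ z, ¬ z ≤ b → φ z = 0 := by
  set s : Set (Cube ι) := ⋃ i ∈ {i | b i ≠ 1}, {z | b i ≤ z i} with hs
  have hsc : IsClosed s := (Set.toFinite _).isClosed_biUnion fun i _ =>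
    isClosed_le continuous_const (continuous_apply i)
  have hd : Disjoint s (Set.Iic a) := by
    rw [Set.disjoint_left]
    intro z hz hza
    simp only [hs, Set.mem_iUnion, Set.mem_ofPred_eq] at hz
    obtain ⟨i, hi, hz⟩ := hz
    exact absurd (hz.trans (hza i)) (not_le.2 ((h i).resolve_right hi))
  obtain ⟨φ, h0, h1, h01⟩ := exists_continuous_zero_one_of_isClosed hsc isClosed_Iic hd
  refine ⟨φ, h01, fun z hz => h1 hz, fun z hz => h0 ?_⟩
  obtain ⟨i, hi⟩ : ∃ i, b i < z i := by simpa [Pi.le_def] using hz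
  simp only [hs, Set.mem_iUnion, Set.mem_ofPred_eq]
  exact ⟨i, (hi.trans_le unitInterval.le_one').ne, hi.le⟩

/-- Under weak convergence `ν k → μ`, the values of `ν k` on `[0,b]` are eventually squeezed
between those of `μ` on `[0,a]` and on `[0,b]`, for `a` strictly below `b`. -/
lemma eventually_squeeze {α : Type*} {l : Filter α} {ν : α → FiniteMeasure (Cube ι)}
    {μ : FiniteMeasure (Cube ι)} (hν : Tendsto ν l (𝓝 μ)) {a b : Cube ι}
    (h : ∀ i, a i < b i ∨ b i = 1) {ε : ℝ} (hε : 0 < ε) :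
    ∀ᶠ k in l, (μ : Measure (Cube ι)).real (Set.Iic a) - ε
        ≤ (ν k : Measure (Cube ι)).real (Set.Iic b) ∧
      (ν k : Measure (Cube ι)).real (Set.Iic b)
        ≤ (μ : Measure (Cube ι)).real (Set.Iic b) + ε := by
  refine Eventually.and ?_ ?_
  · obtain ⟨φ, h01, h1, h0⟩ := exists_continuous_between_Iic h
    have ht := FiniteMeasure.tendsto_iff_forall_integral_tendsto.1 hν
      (BoundedContinuousFunction.mkOfCompact φ)
    have hint : ∀ (m : Measure (Cube ι)) [IsFiniteMeasure m], Integrable φ m := fun m _ =>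
      (BoundedContinuousFunction.mkOfCompact φ).integrable m
    have hle : (μ : Measure (Cube ι)).real (Set.Iic a) ≤ ∫ z, φ z ∂(μ : Measure (Cube ι)) := by
      rw [← integral_indicator_one measurableSet_Iic]
      refine integral_mono ((integrable_const 1).indicator measurableSet_Iic) (hint _) fun z => ?_
      by_cases hz : z ≤ a
      · rw [Set.indicator_of_mem (show z ∈ Set.Iic a from hz), h1 z hz]; rfl
      · rw [Set.indicator_of_notMem (show z ∉ Set.Iic a from hz)]; exact (h01 z).1
    have hge : ∀ k, ∫ z, φ z ∂(ν k : Measure (Cube ι))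
        ≤ (ν k : Measure (Cube ι)).real (Set.Iic b) := by
      intro k
      rw [← integral_indicator_one measurableSet_Iic]
      refine integral_mono (hint _) ((integrable_const 1).indicator measurableSet_Iic) fun z => ?_
      by_cases hz : z ≤ b
      · rw [Set.indicator_of_mem (show z ∈ Set.Iic b from hz)]; exact (h01 z).2
      · rw [Set.indicator_of_notMem (show z ∉ Set.Iic b from hz), h0 z hz]
    filter_upwards [ht.eventually_const_lt
      (show (μ : Measure (Cube ι)).real (Set.Iic a) - ε < _ from
        (sub_lt_self _ hε).trans_le hle)] with k hk
    exact hk.le.trans (hge k)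
  · have hlim := FiniteMeasure.limsup_measure_closed_le_of_tendsto hν
      (isClosed_Iic : IsClosed (Set.Iic b))
    have hlt : (μ : Measure (Cube ι)) (Set.Iic b)
        < (μ : Measure (Cube ι)) (Set.Iic b) + ENNReal.ofReal ε :=
      ENNReal.lt_add_right (measure_ne_top _ _) (by simpa using hε)
    filter_upwards [eventually_lt_of_limsup_lt (hlim.trans_lt hlt)] with k hk
    have := ENNReal.toReal_mono (by finiteness) hk.le
    rwa [ENNReal.toReal_add (by finiteness) (by finiteness), ENNReal.toReal_ofReal hε.le] at this

/-- A signed combination of point masses, split according to the signs of the coefficients. -/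
lemma exists_finiteMeasure_sub_eq {α : Type*} (s : Finset α) (w : α → ℝ) (p : α → Cube ι)
    (C : ℝ≥0) (hC : ∑ a ∈ s, ENNReal.ofReal |w a| ≤ C) :
    ∃ μ ν : FiniteMeasure (Cube ι), μ.mass ≤ C ∧ ν.mass ≤ C ∧
      ∀ x, ∑ a ∈ s, (if ∀ i, p a i ≤ x i then w a else 0) = (μ : Measure (Cube ι)).real (Set.Iic x)
        - (ν : Measure (Cube ι)).real (Set.Iic x) := by
  have hmeas : ∀ v : α → ℝ, ∀ A : Set (Cube ι), MeasurableSet A →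
      (∑ a ∈ s, ENNReal.ofReal (v a) • Measure.dirac (p a)) A
        = ∑ a ∈ s, ENNReal.ofReal (v a) * A.indicator 1 (p a) := by
    intro v A hA
    rw [Measure.finsetSum_apply]
    refine Finset.sum_congr rfl fun a _ => ?_
    rw [Measure.smul_apply, Measure.dirac_apply' _ hA, smul_eq_mul]
  have hmass : ∀ v : α → ℝ, (∀ a, v a ≤ |w a|) →
      (∑ a ∈ s, ENNReal.ofReal (v a) • Measure.dirac (p a)) Set.univ ≤ C := by
    intro v hv
    rw [hmeas v _ MeasurableSet.univ]
    refine le_trans (Finset.sum_le_sum fun a _ => ?_) hC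
    simpa using ENNReal.ofReal_le_ofReal (hv a)
  have hreal : ∀ v : α → ℝ, ∀ x, (∑ a ∈ s, ENNReal.ofReal (v a) • Measure.dirac (p a)).real
      (Set.Iic x) = ∑ a ∈ s, (if ∀ i, p a i ≤ x i then max (v a) 0 else 0) := by
    intro v x
    rw [Measure.real, hmeas v _ measurableSet_Iic, ENNReal.toReal_sum]
    · refine Finset.sum_congr rfl fun a _ => ?_
      by_cases h : ∀ i, p a i ≤ x i
      · rw [Set.indicator_of_mem (show p a ∈ Set.Iic x from h), if_pos h]
        simp [ENNReal.toReal_ofReal']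
      · rw [Set.indicator_of_notMem (show p a ∉ Set.Iic x from h), if_neg h]
        simp
    · intro a _
      by_cases h : ∀ i, p a i ≤ x i
      · rw [Set.indicator_of_mem (show p a ∈ Set.Iic x from h)]
        simp
      · rw [Set.indicator_of_notMem (show p a ∉ Set.Iic x from h)]
        simp
  have h1 := hmass w fun a => le_abs_self _
  have h2 := hmass (fun a => -w a) fun a => neg_le_abs _
  let μ : FiniteMeasure (Cube ι) := ⟨_, ⟨h1.trans_lt ENNReal.coe_lt_top⟩⟩
  let ν : FiniteMeasure (Cube ι) := ⟨_, ⟨h2.trans_lt ENNReal.coe_lt_top⟩⟩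
  refine ⟨μ, ν, ?_, ?_, ?_⟩
  · exact ENNReal.coe_le_coe.1 (by rw [FiniteMeasure.ennreal_mass]; exact h1)
  · exact ENNReal.coe_le_coe.1 (by rw [FiniteMeasure.ennreal_mass]; exact h2)
  · intro x
    rw [FiniteMeasure.toMeasure_mk, FiniteMeasure.toMeasure_mk, hreal, hreal,
      ← Finset.sum_sub_distrib]
    refine Finset.sum_congr rfl fun a _ => ?_
    split_ifs
    · rcases le_total 0 (w a) with h | h
      · rw [max_eq_left h, max_eq_right (by linarith), sub_zero]
      · rw [max_eq_right h, max_eq_left (by linarith)]; ring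
    · simp

end Limits

section Existence

lemma sum_ofReal_abs_cellIncrement_le {ι : Type*} [DecidableEq ι] (f : Cube ι → ℝ) {Y : ι → Finset unitInterval}
    (hY : IsLadder Y) (I : Finset ι) :
    ∑ y ∈ Fintype.piFinset (fun i : {i // i ∈ I} => Y i), ENNReal.ofReal |cellIncrement f Y I y|
      ≤ vitaliVariation (projOne f I) := by
  rw [← ENNReal.ofReal_sum_of_nonneg fun _ _ => abs_nonneg _]
  exact le_iSup₂ (f := fun (Y : {i // i ∈ I} → Finset unitInterval) (_ : IsLadder Y) =>
    ENNReal.ofReal (ladderVariation (projOne f I) Y)) (fun i => Y i) fun i => hY i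

variable {ι : Type*} [Fintype ι] [DecidableEq ι]

/-- If a coordinatewise right-continuous function is close to `c` at all points that lie strictly
above `x` in every coordinate (except where `x i = 1`) and close to `x`, then it is close to `c`
at `x`: right limits are taken in one coordinate after the other. -/
lemma RightContinuous.abs_sub_le {f : Cube ι → ℝ} (hf : RightContinuous f) {x : Cube ι}
    {N : ι → Set unitInterval} (hN : ∀ i, N i ∈ 𝓝 (x i)) {c ε : ℝ}
    (h : ∀ y : Cube ι, (∀ i, y i ∈ N i ∧ (x i < y i ∨ (x i = 1 ∧ y i = 1))) → |f y - c| ≤ ε) :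
    |f x - c| ≤ ε := by
  have key : ∀ J : Finset ι, ∀ y : Cube ι, (∀ i ∈ J, y i = x i) →
      (∀ i ∉ J, y i ∈ N i ∧ (x i < y i ∨ (x i = 1 ∧ y i = 1))) → |f y - c| ≤ ε := by
    intro J
    induction J using Finset.induction_on with
    | empty => exact fun y _ hy => h y fun i => hy i (Finset.notMem_empty i)
    | insert j J hj ih =>
      intro y hyJ hy
      have hyj : y j = x j := hyJ j (Finset.mem_insert_self _ _)
      by_cases hx1 : x j = 1
      · refine ih y (fun i hi => hyJ i (Finset.mem_insert_of_mem hi)) fun i hi => ?_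
        by_cases hij : i = j
        · subst hij
          exact ⟨hyj ▸ mem_of_mem_nhds (hN i), Or.inr ⟨hx1, hyj.trans hx1⟩⟩
        · exact hy i (by simp [hij, hi])
      · have hlt : y j < 1 := lt_of_le_of_ne unitInterval.le_one' (hyj ▸ hx1)
        have hc := (hf y j).tendsto
        rw [Function.update_eq_self] at hc
        have hne : (𝓝[>] (y j)).NeBot := nhdsGT_neBot_of_exists_gt ⟨1, hlt⟩
        have hc' := ((hc.mono_left (nhdsWithin_mono _ Set.Ioi_subset_Ici_self)).sub_const c).abs
        refine le_of_tendsto hc' ?_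
        filter_upwards [self_mem_nhdsWithin, nhdsWithin_le_nhds (hyj ▸ hN j)] with t ht htN
        refine ih _ (fun i hi => ?_) fun i hi => ?_
        · rw [Function.update_of_ne (ne_of_mem_of_not_mem hi hj)]
          exact hyJ i (Finset.mem_insert_of_mem hi)
        · by_cases hij : i = j
          · subst hij
            rw [Function.update_self]
            exact ⟨htN, Or.inl (hyj ▸ ht)⟩
          · rw [Function.update_of_ne hij]
            exact hy i (by simp [hij, hi])
  exact key Finset.univ x (fun _ _ => rfl) fun i hi => absurd (Finset.mem_univ i) hi

/-- A coordinatewise right-continuous function which on every finite set of points is the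
difference of the distribution functions of two measures of bounded mass is the distribution
function of a signed measure. The measures converge weakly along an ultrafilter, by Prokhorov's
theorem on the compact cube. -/
lemma exists_isMeasureOf_of_forall_finset {f : Cube ι → ℝ} (hf : RightContinuous f) (C : ℝ≥0)
    (h : ∀ X : Finset (Cube ι), ∃ μ ν : FiniteMeasure (Cube ι), μ.mass ≤ C ∧ ν.mass ≤ C ∧
      ∀ x ∈ X, f x = (μ : Measure (Cube ι)).real (Set.Iic x)
        - (ν : Measure (Cube ι)).real (Set.Iic x)) :
    ∃ ν, IsMeasureOf f ν := by
  choose m n hm hn hmn using h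
  let U : Ultrafilter (Finset (Cube ι)) := Ultrafilter.of atTop
  have hU : (U : Filter (Finset (Cube ι))) ≤ atTop := Ultrafilter.of_le _
  have hcpt := isCompact_setOfPred_finiteMeasure_le_of_compactSpace (Cube ι) C
  obtain ⟨μ, -, hμ⟩ := hcpt.ultrafilter_le_nhds (U.map m)
    (tendsto_principal.2 (Eventually.of_forall hm) : Tendsto m U (𝓟 _))
  obtain ⟨ν, -, hν⟩ := hcpt.ultrafilter_le_nhds (U.map n)
    (tendsto_principal.2 (Eventually.of_forall hn) : Tendsto n U (𝓟 _))
  have hμ' : Tendsto m U (𝓝 μ) := hμ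
  have hν' : Tendsto n U (𝓝 ν) := hν
  refine ⟨(μ : Measure (Cube ι)).toSignedMeasure - (ν : Measure (Cube ι)).toSignedMeasure,
    fun x => ?_⟩
  rw [sub_apply, Measure.toSignedMeasure_apply_measurable measurableSet_Iic,
    Measure.toSignedMeasure_apply_measurable measurableSet_Iic]
  set p := (μ : Measure (Cube ι)).real with hp
  set q := (ν : Measure (Cube ι)).real with hq
  -- At points strictly above `x` the weak limit pins the value of `f` down up to the mass that
  -- the limit measures give to `[0,y] \ [0,x]`.
  have hbound : ∀ y : Cube ι, (∀ i, x i < y i ∨ (x i = 1 ∧ y i = 1)) →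
      |f y - (p (Set.Iic x) - q (Set.Iic x))| ≤
        (p (Set.Iic y) - p (Set.Iic x)) + (q (Set.Iic y) - q (Set.Iic x)) := by
    intro y hy
    have hy' : ∀ i, x i < y i ∨ y i = 1 := fun i => (hy i).imp_right And.right
    have hxy : x ≤ y := fun i => (hy i).elim le_of_lt fun h => (h.1.trans h.2.symm).le
    have hpm : p (Set.Iic x) ≤ p (Set.Iic y) := measureReal_mono (Set.Iic_subset_Iic.2 hxy)
    have hqm : q (Set.Iic x) ≤ q (Set.Iic y) := measureReal_mono (Set.Iic_subset_Iic.2 hxy)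
    refine le_of_forall_pos_le_add fun ε hε => ?_
    have hmem : ∀ᶠ X in (U : Filter (Finset (Cube ι))), y ∈ X :=
      hU ((eventually_ge_atTop {y}).mono fun X hX => Finset.singleton_subset_iff.1 hX)
    obtain ⟨X, h1, h2, h3⟩ := ((eventually_squeeze hμ' hy' (half_pos hε)).and
      ((eventually_squeeze hν' hy' (half_pos hε)).and hmem)).exists
    rw [hmn X y h3, abs_le]
    constructor <;> linarith
  refine (eq_of_forall_dist_le fun ε hε => ?_).symm
  rw [Real.dist_eq]
  have ht : Tendsto (fun y => (p (Set.Iic y) - p (Set.Iic x)) + (q (Set.Iic y) - q (Set.Iic x)))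
      (𝓝[≥] x) (𝓝 0) := by
    have h1 := (tendsto_real_Iic (μ : Measure (Cube ι)) (l := 𝓝[≥] x) (u := id)
      (tendsto_id.mono_left nhdsWithin_le_nhds) self_mem_nhdsWithin).sub_const (p (Set.Iic x))
    have h2 := (tendsto_real_Iic (ν : Measure (Cube ι)) (l := 𝓝[≥] x) (u := id)
      (tendsto_id.mono_left nhdsWithin_le_nhds) self_mem_nhdsWithin).sub_const (q (Set.Iic x))
    have h3 := h1.add h2
    rwa [hp, hq, sub_self, sub_self, add_zero] at h3
  have hev := ht.eventually_le_const hε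
  rw [eventually_nhdsWithin_iff, nhds_pi, Filter.eventually_iff, Filter.mem_pi'] at hev
  obtain ⟨I, N, hN, hsub⟩ := hev
  refine hf.abs_sub_le hN fun y hy => (hbound y fun i => (hy i).2).trans ?_
  exact hsub (fun i _ => (hy i).1) fun i => (hy i).2.elim le_of_lt fun h => (h.1.trans h.2.symm).le

/-- Inclusion-exclusion for the indicator of the open upper orthant. -/
lemma sum_powerset_ite_le (I : Finset ι) (x y : ι → unitInterval) :
    ∑ K ∈ I.powerset, (-1 : ℝ) ^ K.card * (if ∀ i ∈ K, y i ≤ x i then 1 else 0)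
      = if ∀ i ∈ I, x i < y i then 1 else 0 := by
  have h := Finset.prod_sub (R := ℝ) (fun _ => 1) (fun i => if y i ≤ x i then 1 else 0) I
  simp only [Finset.prod_const_one, mul_one, Finset.prod_ite_zero] at h
  rw [← h]
  have : ∀ i ∈ I, (1 : ℝ) - (if y i ≤ x i then 1 else 0) = if x i < y i then 1 else 0 := by
    intro i _
    by_cases hi : y i ≤ x i
    · rw [if_pos hi, if_neg hi.not_gt, sub_self]
    · rw [if_neg hi, if_pos (not_le.1 hi), sub_zero]
  rw [Finset.prod_congr rfl this, Finset.prod_ite_zero]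
  simp

/-- The values at grid points are the distribution function of a signed combination of point
masses: each increment over a cell `(y, y⁺]` of the face `I` contributes the signed point masses
at the projections of `y⁺` to the subfaces of the lower boundary. -/
lemma sum_ite_le_eq (f : Cube ι → ℝ) {Y : ι → Finset unitInterval} (hY : ∀ i, 1 ∉ Y i)
    {x : Cube ι} (hx : ∀ i, x i = 1 ∨ x i ∈ Y i) :
    ∑ I : Finset ι, ∑ y ∈ Fintype.piFinset (fun i : {i // i ∈ I} => Y i), ∑ K ∈ I.powerset,
      (if ∀ i, (if h : i ∈ I then if i ∈ K then successor (Y i) (y ⟨i, h⟩) else 0 else 0) ≤ x i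
        then (-1) ^ I.card * (-1) ^ K.card * cellIncrement f Y I y else 0) = f x := by
  have hfx : f x = stepSum f Y x := by
    rw [stepSum_eq]
    congr 1
    ext1 i
    exact (roundUp_eq_self (hx i)).symm
  rw [hfx, stepSum]
  refine Finset.sum_congr rfl fun I _ => ?_
  rw [Finset.mul_sum]
  refine Finset.sum_congr rfl fun y hy => ?_
  set u : ι → unitInterval := fun i => if h : i ∈ I then successor (Y i) (y ⟨i, h⟩) else 0 with hu
  have h1 : ∀ K ∈ I.powerset, ((∀ i, (if h : i ∈ I then if i ∈ K then successor (Y i) (y ⟨i, h⟩)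
      else 0 else 0) ≤ x i) ↔ ∀ i ∈ K, u i ≤ x i) := by
    intro K hK
    refine forall_congr' fun i => ?_
    by_cases hi : i ∈ K
    · have hI := Finset.mem_powerset.1 hK hi
      simp [hu, hi, hI]
    · simp only [hi, if_false, dite_eq_ite, ite_self, false_imp_iff, iff_true]
      exact unitInterval.nonneg'
  have h2 : (∀ i : {i // i ∈ I}, x i ≤ y i) ↔ ∀ i ∈ I, x i < u i := by
    rw [Subtype.forall]
    refine forall₂_congr fun i hi => ?_
    simp only [hu, hi, dif_pos]
    exact (lt_successor_iff (hY i) (Fintype.mem_piFinset.1 hy ⟨i, hi⟩) (hx i)).symm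
  have h3 := sum_powerset_ite_le I x u
  calc _ = ∑ K ∈ I.powerset, ((-1) ^ I.card * cellIncrement f Y I y) *
        ((-1 : ℝ) ^ K.card * (if ∀ i ∈ K, u i ≤ x i then 1 else 0)) := by
        refine Finset.sum_congr rfl fun K hK => ?_
        rw [if_congr (h1 K hK) rfl rfl]
        split_ifs <;> ring
    _ = _ := by
        rw [← Finset.mul_sum, h3, if_congr h2 rfl rfl]
        split_ifs <;> ring

/-- **Existence of the signed measure** of a right-continuous function of bounded Hardy-Krause
variation. -/
theorem IsRCBoundedHK.exists_isMeasureOf {f : Cube ι → ℝ} (hf : IsRCBoundedHK f) :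
    ∃ ν, IsMeasureOf f ν := by
  refine exists_isMeasureOf_of_forall_finset hf.rightContinuous
    (2 ^ Fintype.card ι * (hardyKrauseVariation f).toNNReal) fun X => ?_
  -- The smallest ladder that contains all coordinates different from `1` of points of `X`.
  let Y : ι → Finset unitInterval := fun i => insert 0 ((X.image (fun x => x i)).erase 1)
  have hY : IsLadder Y := fun i => ⟨Finset.mem_insert_self _ _, by simp [Y]⟩
  have hXY : ∀ x ∈ X, ∀ i, x i = 1 ∨ x i ∈ Y i := by
    intro x hx i
    by_cases h1 : x i = 1
    · exact Or.inl h1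
    · exact Or.inr (Finset.mem_insert_of_mem
        (Finset.mem_erase.2 ⟨h1, Finset.mem_image_of_mem _ hx⟩))
  let s : Finset ((I : Finset ι) × Cube {i // i ∈ I} × Finset ι) :=
    Finset.univ.sigma fun I => Fintype.piFinset (fun i : {i // i ∈ I} => Y i) ×ˢ I.powerset
  have hC : ∑ a ∈ s, ENNReal.ofReal
      |(-1) ^ a.1.card * (-1) ^ a.2.2.card * cellIncrement f Y a.1 a.2.1|
      ≤ (2 ^ Fintype.card ι * (hardyKrauseVariation f).toNNReal : ℝ≥0) := by
    push_cast
    rw [ENNReal.coe_toNNReal hf.variation_lt_top.ne, Finset.sum_sigma, hardyKrauseVariation,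
      Finset.mul_sum]
    refine Finset.sum_le_sum fun I _ => ?_
    rw [Finset.sum_product_right]
    simp only [abs_mul, abs_pow, abs_neg, abs_one, one_pow, one_mul, Finset.sum_const,
      Finset.card_powerset, nsmul_eq_mul]
    push_cast
    gcongr
    · norm_num
    · exact Finset.card_le_univ I
    · exact sum_ofReal_abs_cellIncrement_le f hY I
  obtain ⟨μ, ν, hμ, hν, h⟩ := exists_finiteMeasure_sub_eq s
    (fun a => (-1) ^ a.1.card * (-1) ^ a.2.2.card * cellIncrement f Y a.1 a.2.1)
    (fun a i => if h : i ∈ a.1 then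
      if i ∈ a.2.2 then successor (Y i) (a.2.1 ⟨i, h⟩) else 0 else 0)
    (2 ^ Fintype.card ι * (hardyKrauseVariation f).toNNReal) hC
  refine ⟨μ, ν, hμ, hν, fun x hx => ?_⟩
  rw [← h x, ← sum_ite_le_eq f (fun i => (hY i).2) (hXY x hx), Finset.sum_sigma]
  refine Finset.sum_congr rfl fun I _ => ?_
  rw [Finset.sum_product]

end Existence

/-! ### The integral as a bounded functional of the integrator -/

section UniformGrid

/-- The point `j/(k+1)` of the unit interval, for `j ≤ k`. -/
def gridPoint (k : ℕ) (j : Fin (k + 1)) : unitInterval :=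
  ⟨(j : ℝ) / (k + 1), by positivity, by
    rw [div_le_one (by positivity)]; exact_mod_cast j.2.le⟩

/-- The grid `{0, 1/(k+1), …, k/(k+1)}`. -/
def uniformGrid (k : ℕ) : Finset unitInterval :=
  Finset.univ.image (gridPoint k)

lemma zero_mem_uniformGrid (k : ℕ) : 0 ∈ uniformGrid k :=
  Finset.mem_image.2 ⟨0, Finset.mem_univ _, Subtype.ext (by simp [gridPoint])⟩

lemma one_notMem_uniformGrid (k : ℕ) : 1 ∉ uniformGrid k := by
  intro h
  obtain ⟨j, -, hj⟩ := Finset.mem_image.1 h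
  have h1 : (j : ℝ) / (k + 1) = 1 := congrArg Subtype.val hj
  rw [div_eq_one_iff_eq (by positivity)] at h1
  have h2 : (j : ℕ) = k + 1 := by exact_mod_cast h1
  exact absurd j.2 (by omega)

lemma roundUp_uniformGrid_le (k : ℕ) (t : unitInterval) :
    (roundUp (uniformGrid k) t : ℝ) ≤ t + 1 / (k + 1) := by
  have hk : (0 : ℝ) < k + 1 := by positivity
  have hlt := Nat.ceil_lt_add_one (mul_nonneg t.2.1 hk.le)
  have hle := Nat.le_ceil ((t : ℝ) * (k + 1))
  set j := ⌈(t : ℝ) * (k + 1)⌉₊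
  have hj : (j : ℝ) / (k + 1) ≤ t + 1 / (k + 1) := by
    rw [div_le_iff₀ hk, add_mul, one_div, inv_mul_cancel₀ hk.ne']
    exact hlt.le
  refine le_trans ?_ hj
  by_cases hjk : j < k + 1
  · exact roundUp_le (Finset.mem_image_of_mem (gridPoint k) (Finset.mem_univ ⟨j, hjk⟩))
      (show (t : ℝ) ≤ (j : ℝ) / (k + 1) by rwa [le_div_iff₀ hk])
  · refine (roundUp (uniformGrid k) t).2.2.trans ?_
    rw [one_le_div hk]
    exact_mod_cast not_lt.1 hjk

lemma tendsto_roundUp_uniformGrid (t : unitInterval) :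
    Tendsto (fun k => roundUp (uniformGrid k) t) atTop (𝓝 t) := by
  rw [tendsto_subtype_rng]
  refine tendsto_of_tendsto_of_tendsto_of_le_of_le tendsto_const_nhds ?_
    (fun k => le_roundUp (uniformGrid k) t) (fun k => roundUp_uniformGrid_le k t)
  simpa using tendsto_one_div_add_atTop_nhds_zero_nat.const_add (t : ℝ)

end UniformGrid

section Integral

variable {ι : Type*} [Fintype ι] [DecidableEq ι]

lemma stepSum_eq_sum_indicator (f : Cube ι → ℝ) (Y : ι → Finset unitInterval) (x : Cube ι) :
    stepSum f Y x = ∑ I : Finset ι, ∑ y ∈ Fintype.piFinset (fun i : {i // i ∈ I} => Y i),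
      (Set.Iic (fun i => if h : i ∈ I then y ⟨i, h⟩ else 1)).indicator
        (fun _ => (-1) ^ I.card * cellIncrement f Y I y) x := by
  unfold stepSum
  refine Finset.sum_congr rfl fun I _ => ?_
  rw [Finset.mul_sum]
  refine Finset.sum_congr rfl fun y _ => ?_
  have : (∀ i : {i // i ∈ I}, x i ≤ y i) ↔
      x ∈ Set.Iic (fun i => if h : i ∈ I then y ⟨i, h⟩ else 1) := by
    rw [Set.mem_Iic, Pi.le_def, Subtype.forall]
    refine forall_congr' fun i => ?_
    by_cases hi : i ∈ I
    · simp [hi]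
    · simp [hi, unitInterval.le_one']
  by_cases h : ∀ i : {i // i ∈ I}, x i ≤ y i
  · rw [if_pos h, Set.indicator_of_mem (this.1 h)]
  · rw [if_neg h, Set.indicator_of_notMem (mt this.2 h), mul_zero]

lemma measurable_stepSum (f : Cube ι → ℝ) (Y : ι → Finset unitInterval) :
    Measurable (stepSum f Y) := by
  simp only [funext (stepSum_eq_sum_indicator f Y)]
  exact Finset.measurable_fun_sum _ fun I _ => Finset.measurable_fun_sum _ fun y _ =>
    measurable_const.indicator measurableSet_Iic

instance (ν : SignedMeasure (Cube ι)) : IsFiniteMeasure ν.variation := by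
  rw [← SignedMeasure.totalVariation_eq_variation]; infer_instance

/-- Summation by parts turns the integral of the step function into a combination of values of
the integrator, with the increments of the integrand as coefficients. -/
lemma abs_integral_stepSum_le {f g : Cube ι → ℝ} (hf : hardyKrauseVariation f < ∞)
    {ν : SignedMeasure (Cube ι)} (hg : IsMeasureOf g ν) {M : ℝ} (hM : ∀ x, |g x| ≤ M)
    {Y : ι → Finset unitInterval} (hY : IsLadder Y) :
    |ν.integral (stepSum f Y) (ContinuousLinearMap.lsmul ℝ ℝ)|
      ≤ (hardyKrauseVariation f).toReal * M := by
  have hM0 : 0 ≤ M := (abs_nonneg _).trans (hM 0)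
  have hint : ∀ (I : Finset ι) (y : Cube {i // i ∈ I}), ν.Integrable
      ((Set.Iic (fun i => if h : i ∈ I then y ⟨i, h⟩ else 1)).indicator
        (fun _ => (-1) ^ I.card * cellIncrement f Y I y)) := fun I y =>
    (integrable_const _).indicator measurableSet_Iic
  have hval : ν.integral (stepSum f Y) (ContinuousLinearMap.lsmul ℝ ℝ)
      = ∑ I : Finset ι, ∑ y ∈ Fintype.piFinset (fun i : {i // i ∈ I} => Y i),
        (-1) ^ I.card * cellIncrement f Y I y * g (fun i => if h : i ∈ I then y ⟨i, h⟩ else 1) := by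
    simp only [funext (stepSum_eq_sum_indicator f Y)]
    rw [VectorMeasure.integral_finsetSum _ fun I _ => integrable_finsetSum _ fun y _ => hint I y]
    refine Finset.sum_congr rfl fun I _ => ?_
    rw [VectorMeasure.integral_finsetSum _ fun y _ => hint I y]
    refine Finset.sum_congr rfl fun y _ => ?_
    rw [VectorMeasure.integral_indicator measurableSet_Iic, VectorMeasure.setIntegral_const, hg]
    rfl
  have hsum : ∀ I, ∑ y ∈ Fintype.piFinset (fun i : {i // i ∈ I} => Y i), |cellIncrement f Y I y|
      ≤ (vitaliVariation (projOne f I)).toReal := by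
    intro I
    have hlt : vitaliVariation (projOne f I) < ∞ :=
      (Finset.single_le_sum (f := fun I => vitaliVariation (projOne f I))
        (fun _ _ => zero_le) (Finset.mem_univ I)).trans_lt hf
    have := sum_ofReal_abs_cellIncrement_le f hY I
    rw [← ENNReal.ofReal_sum_of_nonneg fun _ _ => abs_nonneg _] at this
    exact (ENNReal.ofReal_le_iff_le_toReal hlt.ne).1 this
  rw [hval, hardyKrauseVariation, ENNReal.toReal_sum fun I _ =>
    ((Finset.single_le_sum (f := fun I => vitaliVariation (projOne f I))
        (fun _ _ => zero_le) (Finset.mem_univ I)).trans_lt hf).ne, Finset.sum_mul]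
  refine (Finset.abs_sum_le_sum_abs _ _).trans (Finset.sum_le_sum fun I _ => ?_)
  refine (Finset.abs_sum_le_sum_abs _ _).trans ?_
  refine le_trans ?_ (mul_le_mul_of_nonneg_right (hsum I) hM0)
  rw [Finset.sum_mul]
  refine Finset.sum_le_sum fun y _ => ?_
  rw [abs_mul, abs_mul, abs_pow, abs_neg, abs_one, one_pow, one_mul]
  exact mul_le_mul_of_nonneg_left (hM _) (abs_nonneg _)

lemma IsRCBoundedHK.tendsto_stepSum {f : Cube ι → ℝ} (hf : IsRCBoundedHK f) (x : Cube ι) :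
    Tendsto (fun k => stepSum f (fun _ => uniformGrid k) x) atTop (𝓝 (f x)) := by
  obtain ⟨μ, hμ⟩ := hf.exists_isMeasureOf
  simp only [stepSum_eq]
  exact hμ.tendsto (tendsto_pi_nhds.2 fun i => tendsto_roundUp_uniformGrid (x i))
    (Eventually.of_forall fun k i => le_roundUp _ _)

lemma IsRCBoundedHK.measurable {f : Cube ι → ℝ} (hf : IsRCBoundedHK f) : Measurable f :=
  measurable_of_tendsto_metrizable (fun k => measurable_stepSum f fun _ => uniformGrid k)
    (tendsto_pi_nhds.2 hf.tendsto_stepSum)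

lemma IsRCBoundedHK.exists_abs_le {f : Cube ι → ℝ} (hf : IsRCBoundedHK f) : ∃ B, ∀ x, |f x| ≤ B :=
  hf.exists_isMeasureOf.elim fun _ hμ => ⟨_, hμ.abs_le⟩

lemma IsRCBoundedHK.integrable {f : Cube ι → ℝ} (hf : IsRCBoundedHK f)
    (ν : SignedMeasure (Cube ι)) : ν.Integrable f := by
  obtain ⟨B, hB⟩ := hf.exists_abs_le
  exact Integrable.of_bound hf.measurable.aestronglyMeasurable B (Eventually.of_forall hB)

/-- The integral is bounded by the variation of the integrand and the supremum of the
distribution function of the integrator, whatever the total variation of the latter. -/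
lemma IsRCBoundedHK.abs_integral_le {f g : Cube ι → ℝ} (hf : IsRCBoundedHK f)
    {ν : SignedMeasure (Cube ι)} (hg : IsMeasureOf g ν) {M : ℝ} (hM : ∀ x, |g x| ≤ M) :
    |ν.integral f (ContinuousLinearMap.lsmul ℝ ℝ)| ≤ (hardyKrauseVariation f).toReal * M := by
  obtain ⟨B, hB⟩ := hf.exists_abs_le
  have ht := VectorMeasure.tendsto_integral_of_dominated_convergence (μ := ν)
    (B := ContinuousLinearMap.lsmul ℝ ℝ) (fun _ => B)
    (fun k => (measurable_stepSum f fun _ => uniformGrid k).aestronglyMeasurable)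
    (integrable_const B)
    (fun k => Eventually.of_forall fun x => by rw [stepSum_eq]; exact hB _)
    (Eventually.of_forall hf.tendsto_stepSum)
  exact le_of_tendsto ht.abs (Eventually.of_forall fun k =>
    abs_integral_stepSum_le hf.variation_lt_top hg hM
      fun _ => ⟨zero_mem_uniformGrid k, one_notMem_uniformGrid k⟩)

omit [Fintype ι] [DecidableEq ι] in
lemma isMeasureOf_measureOf {g : Cube ι → ℝ} (h : ∃ ν, IsMeasureOf g ν) :
    IsMeasureOf g (measureOf g) := by
  rw [measureOf, dif_pos h]
  exact h.choose_spec

variable (ι) in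
/-- The bounded functions on the cube that are distribution functions of signed measures. -/
def distributionFunctions : Submodule ℝ (LInf (Cube ι)) where
  carrier := {g | ∃ ν, IsMeasureOf (fun x => g x) ν}
  zero_mem' := ⟨0, fun x => by simp⟩
  add_mem' := by
    rintro g h ⟨ν, hν⟩ ⟨μ, hμ⟩
    exact ⟨ν + μ, fun x => by simp [hν x, hμ x]⟩
  smul_mem' := by
    rintro c g ⟨ν, hν⟩
    exact ⟨c • ν, fun x => by simp [hν x]⟩

/-- The integral against a fixed integrand of bounded variation extends from distribution
functions to a continuous linear functional on all bounded functions, by the Hahn-Banach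
theorem. -/
lemma IsRCBoundedHK.exists_functional {f : Cube ι → ℝ} (hf : IsRCBoundedHK f) :
    ∃ ψ : LInf (Cube ι) →L[ℝ] ℝ, ‖ψ‖ ≤ (hardyKrauseVariation f).toReal ∧
      ∀ g ∈ distributionFunctions ι, ψ g = stieltjesIntegral f (fun x => g x) := by
  have hspec : ∀ g : distributionFunctions ι, IsMeasureOf (fun x => (g : LInf (Cube ι)) x)
      (measureOf fun x => (g : LInf (Cube ι)) x) := fun g => isMeasureOf_measureOf g.2
  let φ : distributionFunctions ι →ₗ[ℝ] ℝ :=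
    { toFun := fun g => stieltjesIntegral f (fun x => (g : LInf (Cube ι)) x)
      map_add' := fun g h => by
        have : measureOf (fun x => ((g + h : distributionFunctions ι) : LInf (Cube ι)) x)
            = measureOf (fun x => (g : LInf (Cube ι)) x)
              + measureOf (fun x => (h : LInf (Cube ι)) x) :=
          (hspec (g + h)).unique fun x => by
            rw [add_apply, hspec g x, hspec h x]; simp
        rw [stieltjesIntegral, this, VectorMeasure.integral_add_vectorMeasure (hf.integrable _)
          (hf.integrable _)]
        rfl
      map_smul' := fun c g => by
        have : measureOf (fun x => ((c • g : distributionFunctions ι) : LInf (Cube ι)) x)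
            = c • measureOf (fun x => (g : LInf (Cube ι)) x) :=
          (hspec (c • g)).unique fun x => by
            rw [smul_apply, hspec g x]; simp
        rw [stieltjesIntegral, this, VectorMeasure.integral_smul_vectorMeasure]
        rfl }
  have hφ : ∀ g, ‖φ g‖ ≤ (hardyKrauseVariation f).toReal * ‖g‖ := fun g =>
    hf.abs_integral_le (hspec g) fun x =>
    lp.norm_apply_le_norm ENNReal.top_ne_zero (g : LInf (Cube ι)) x
  obtain ⟨ψ, hψ, hψn⟩ := exists_extension_norm_eq (distributionFunctions ι)
    (φ.mkContinuous _ hφ)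
  refine ⟨ψ, hψn.trans_le (φ.mkContinuous_norm_le ENNReal.toReal_nonneg hφ), fun g hg => ?_⟩
  exact hψ ⟨g, hg⟩

/-- For a class of integrands of uniformly bounded variation, integration is the restriction of
a continuous linear operator between spaces of bounded functions. -/
lemma exists_integration_operator (T : ℝ≥0) (F : Set (Cube ι → ℝ))
    (hF : ∀ f ∈ F, IsRCBoundedHK f ∧ hardyKrauseVariation f ≤ T) :
    ∃ Φ : LInf (Cube ι) →L[ℝ] LInf F, ∀ g ∈ distributionFunctions ι, ∀ f : F,
      Φ g f = stieltjesIntegral (f : Cube ι → ℝ) (fun x => g x) := by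
  choose ψ hψn hψ using fun f : F => (hF f f.2).1.exists_functional
  have hb : ∀ g f, ‖ψ f g‖ ≤ T * ‖g‖ := fun g f =>
    ((ψ f).le_opNorm g).trans (mul_le_mul_of_nonneg_right ((hψn f).trans
      (ENNReal.toReal_le_coe_of_le_coe (hF f f.2).2)) (norm_nonneg _))
  let Φ : LInf (Cube ι) →ₗ[ℝ] LInf F :=
    { toFun := fun g => ⟨fun f => ψ f g, memℓp_infty ⟨T * ‖g‖, by
        rintro _ ⟨f, rfl⟩; exact hb g f⟩⟩
      map_add' := fun g h => by ext f; simp; rfl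
      map_smul' := fun c g => by ext f; simp }
  refine ⟨Φ.mkContinuous T fun g => ?_, fun g hg f => hψ f g hg⟩
  exact lp.norm_le_of_forall_le (by positivity) (hb g)

end Integral

/-! ### Limits of Gaussian processes -/

section Gaussian

/-- If the characters `exp(i t m_k)` converge for every `t`, then `m_k` converges: integrating
`exp(i t (m_k - m_l)) → 1` over `t` against the standard Gaussian gives
`exp(-(m_k - m_l)² / 2) → 1`, so that `m` is a Cauchy sequence. -/
lemma exists_tendsto_of_tendsto_cexp {m : ℕ → ℝ} {χ : ℝ → ℂ}
    (h : ∀ t : ℝ, Tendsto (fun k => Complex.exp (t * m k * Complex.I)) atTop (𝓝 (χ t))) :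
    ∃ a, Tendsto m atTop (𝓝 a) := by
  have hnorm : ∀ t x : ℝ, ‖Complex.exp (t * x * Complex.I)‖ = 1 := fun t x => by
    rw [← Complex.ofReal_mul, Complex.norm_exp_ofReal_mul_I]
  have hχ : ∀ t, χ t * (starRingEnd ℂ) (χ t) = 1 := by
    intro t
    have h1 : ‖χ t‖ = 1 := tendsto_nhds_unique (h t).norm (by simp [hnorm])
    rw [Complex.mul_conj, Complex.normSq_eq_norm_sq, h1]; simp
  have hpair : ∀ t : ℝ, Tendsto (fun p : ℕ × ℕ =>
      Complex.exp ((m p.1 - m p.2 : ℝ) * t * Complex.I)) atTop (𝓝 1) := by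
    intro t
    have h2 := ((h t).comp (tendsto_fst (f := atTop) (g := atTop))).mul
      ((Complex.continuous_conj.tendsto _).comp ((h t).comp (tendsto_snd (f := atTop) (g := atTop))))
    rw [hχ, prod_atTop_atTop_eq] at h2
    refine h2.congr fun p => ?_
    simp only [Function.comp_apply, ← Complex.exp_conj, ← Complex.exp_add, map_mul,
      Complex.conj_ofReal, Complex.conj_I]
    push_cast
    ring_nf
  have hint : Tendsto (fun p : ℕ × ℕ => charFun (gaussianReal 0 1) (m p.1 - m p.2)) atTop
      (𝓝 1) := by
    simp only [charFun_apply_real]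
    have h3 := tendsto_integral_filter_of_dominated_convergence (μ := gaussianReal 0 1)
      (l := (atTop : Filter (ℕ × ℕ))) (F := fun (p : ℕ × ℕ) (t : ℝ) =>
        Complex.exp ((m p.1 - m p.2 : ℝ) * t * Complex.I)) (f := fun _ => 1) (fun _ => 1)
      (Eventually.of_forall fun p => by fun_prop)
      (Eventually.of_forall fun p => Eventually.of_forall fun t => (hnorm _ _).le)
      (integrable_const _) (Eventually.of_forall hpair)
    simpa using h3
  have hlog : Tendsto (fun p : ℕ × ℕ => dist (m p.1) (m p.2)) atTop (𝓝 0) := by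
    have h4 : Tendsto (fun p : ℕ × ℕ => Real.exp (-(m p.1 - m p.2) ^ 2 / 2)) atTop (𝓝 1) := by
      have := hint.norm
      simp only [charFun_gaussianReal, norm_one, Complex.norm_exp] at this
      refine this.congr fun p => ?_
      congr 1
      simp [-Complex.ofReal_sub, ← Complex.ofReal_pow]
      ring
    have h5 := ((Real.continuousAt_log one_ne_zero).tendsto.comp h4).const_mul (-2)
    have h6 := (Real.continuous_sqrt.tendsto _).comp h5
    simp only [Real.log_one, mul_zero, Real.sqrt_zero] at h6
    refine h6.congr fun p => ?_
    simp only [Function.comp_apply, Real.log_exp]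
    rw [Real.dist_eq, ← Real.sqrt_sq_eq_abs]
    congr 1; ring
  refine cauchySeq_tendsto_of_complete ?_
  rw [cauchySeq_iff_tendsto_dist_atTop_0]
  exact hlog

variable {Ω : Type*} [MeasurableSpace Ω] {P : Measure Ω} [IsProbabilityMeasure P]

/-- An almost sure limit of real Gaussian random variables is Gaussian. -/
lemma hasGaussianLaw_of_ae_tendsto_real {X : ℕ → Ω → ℝ} {Y : Ω → ℝ}
    (hX : ∀ k, HasGaussianLaw (X k) P)
    (h : ∀ᵐ ω ∂P, Tendsto (fun k => X k ω) atTop (𝓝 (Y ω))) : HasGaussianLaw Y P := by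
  have hY : AEMeasurable Y P := aemeasurable_of_tendsto_metrizable_ae atTop
    (fun k => (hX k).aemeasurable) h
  have hYp : IsProbabilityMeasure (P.map Y) := Measure.isProbabilityMeasure_map hY
  set m : ℕ → ℝ := fun k => P[X k] with hm
  set v : ℕ → ℝ≥0 := fun k => Var[X k; P].toNNReal with hv
  set φ : ℝ → ℂ := charFun (P.map Y) with hφ
  have hlim : ∀ t : ℝ, Tendsto (fun k => Complex.exp (t * m k * Complex.I - v k * t ^ 2 / 2)) atTop
      (𝓝 (φ t)) := by
    intro t
    have hc : ∀ Z : Ω → ℝ, AEMeasurable Z P →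
        charFun (P.map Z) t = ∫ ω, Complex.exp (t * Z ω * Complex.I) ∂P := by
      intro Z hZ
      rw [charFun_apply_real, integral_map hZ (by fun_prop)]
    simp only [← charFun_gaussianReal, hm, hv, ← (hX _).map_eq_gaussianReal]
    simp only [hφ, hc _ hY, hc _ (hX _).aemeasurable]
    refine tendsto_integral_of_dominated_convergence (fun _ => 1) (fun k => ?_) (integrable_const _)
      (fun k => Eventually.of_forall fun ω => ?_) ?_
    · have := (hX k).aemeasurable
      exact AEMeasurable.aestronglyMeasurable (by fun_prop)
    · rw [← Complex.ofReal_mul, Complex.norm_exp_ofReal_mul_I]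
    · filter_upwards [h] with ω hω
      have hcont : Continuous fun x : ℝ => Complex.exp (t * x * Complex.I) := by fun_prop
      exact (hcont.tendsto _).comp hω
  have hnorm : ∀ t : ℝ, Tendsto (fun k => Real.exp (-(v k * t ^ 2 / 2))) atTop (𝓝 ‖φ t‖) := by
    intro t
    refine (hlim t).norm.congr fun k => ?_
    rw [Complex.norm_exp]
    congr 1
    simp [← Complex.ofReal_pow]
  obtain ⟨t, ht, hφt⟩ : ∃ t : ℝ, t ≠ 0 ∧ φ t ≠ 0 := by
    have hcont : ContinuousAt φ 0 := continuous_charFun.continuousAt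
    have h0 : φ 0 ≠ 0 := by simp [hφ]
    have hev := (hcont.eventually_ne h0).filter_mono (nhdsWithin_le_nhds (s := {0}ᶜ))
    obtain ⟨t, h1, h2⟩ := (hev.and self_mem_nhdsWithin).exists
    exact ⟨t, h2, h1⟩
  -- The variances converge because the moduli of the characteristic functions converge to a
  -- nonzero value at some `t ≠ 0`.
  have hvlim : Tendsto (fun k => (v k : ℝ)) atTop (𝓝 (Real.log ‖φ t‖ * (-2 / t ^ 2))) := by
    refine ((hnorm t).log (norm_ne_zero_iff.2 hφt)).mul_const (-2 / t ^ 2) |>.congr fun k => ?_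
    rw [Real.log_exp]
    field_simp
  have hv0 : 0 ≤ Real.log ‖φ t‖ * (-2 / t ^ 2) := ge_of_tendsto' hvlim fun k => (v k).2
  obtain ⟨V, hV⟩ : ∃ V : ℝ≥0, (V : ℝ) = Real.log ‖φ t‖ * (-2 / t ^ 2) := ⟨⟨_, hv0⟩, rfl⟩
  rw [← hV] at hvlim
  have hvC : ∀ t : ℝ, Tendsto (fun k => Complex.exp (v k * t ^ 2 / 2)) atTop
      (𝓝 (Complex.exp (V * t ^ 2 / 2))) := by
    intro t
    have hcont : Continuous fun x : ℝ => Complex.exp (x * t ^ 2 / 2) := by fun_prop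
    exact (hcont.tendsto _).comp hvlim
  obtain ⟨a, ha⟩ := exists_tendsto_of_tendsto_cexp (m := m)
    (χ := fun t => φ t * Complex.exp (V * t ^ 2 / 2)) fun t => by
      refine ((hlim t).mul (hvC t)).congr fun k => ?_
      rw [← Complex.exp_add]
      congr 1; ring
  have hlaw : P.map Y = gaussianReal a V := by
    refine Measure.ext_of_charFun (funext fun t => ?_)
    rw [charFun_gaussianReal]
    refine tendsto_nhds_unique (hlim t) ?_
    have hcont : Continuous fun p : ℝ × ℝ =>
        Complex.exp (t * p.1 * Complex.I - p.2 * t ^ 2 / 2) := by fun_prop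
    have hpair : Tendsto (fun k => (m k, (v k : ℝ))) atTop (𝓝 (a, (V : ℝ))) :=
      ha.prodMk_nhds hvlim
    have hfin := (hcont.tendsto (a, (V : ℝ))).comp hpair
    exact hfin
  exact ⟨by rw [hlaw]; infer_instance⟩

/-- Pointwise almost sure limits of Gaussian processes are Gaussian. -/
lemma isGaussianProcess_of_ae_tendsto {S : Type*} {X : ℕ → S → Ω → ℝ} {Y : S → Ω → ℝ}
    (hX : ∀ k, IsGaussianProcess (X k) P)
    (h : ∀ s, ∀ᵐ ω ∂P, Tendsto (fun k => X k s ω) atTop (𝓝 (Y s ω))) :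
    IsGaussianProcess Y P where
  hasGaussianLaw I := by
    have hm : ∀ s, AEMeasurable (Y s) P := fun s =>
      (hasGaussianLaw_of_ae_tendsto_real (fun k => (hX k).hasGaussianLaw_eval s) (h s)).aemeasurable
    have hmI : AEMeasurable (fun ω => I.restrict (Y · ω)) P :=
      aemeasurable_pi_lambda _ fun s => hm s
    refine ⟨isGaussian_of_isGaussian_map fun L => ?_⟩
    rw [AEMeasurable.map_map_of_aemeasurable (by fun_prop) hmI]
    refine (hasGaussianLaw_of_ae_tendsto_real (fun k => ((hX k).hasGaussianLaw I).map L)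
      ?_).isGaussian_map
    filter_upwards [ae_all_iff.2 fun s : I => h s] with ω hω
    exact (L.continuous.tendsto _).comp (tendsto_pi_nhds.2 hω)

end Gaussian

/-! ### Continuous linear images of Gaussian laws on bounded functions -/

section Image

variable {ι : Type*} [Fintype ι] [DecidableEq ι]

/-- The indicator function of the cell of the points of the cube that are rounded up to `p`. -/
def cellIndicator (k : ℕ) (p : Cube ι) : LInf (Cube ι) :=
  ⟨fun x => if (fun i => roundUp (uniformGrid k) (x i)) = p then 1 else 0,
    memℓp_infty ⟨1, by rintro _ ⟨x, rfl⟩; dsimp only; split_ifs <;> simp⟩⟩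

/-- The step function that interpolates `z` at the points of the uniform grid. -/
def discretize (k : ℕ) (z : LInf (Cube ι)) : LInf (Cube ι) :=
  ∑ p ∈ Fintype.piFinset fun _ => insert 1 (uniformGrid k), z p • cellIndicator k p

lemma discretize_apply (k : ℕ) (z : LInf (Cube ι)) (x : Cube ι) :
    discretize k z x = z fun i => roundUp (uniformGrid k) (x i) := by
  have hmem : (fun i => roundUp (uniformGrid k) (x i)) ∈
      Fintype.piFinset fun _ : ι => insert 1 (uniformGrid k) :=
    Fintype.mem_piFinset.2 fun i => Finset.mem_insert.2 (roundUp_mem _ _)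
  have : discretize k z x = ∑ p ∈ Fintype.piFinset fun _ => insert 1 (uniformGrid k),
      z p * (if (fun i => roundUp (uniformGrid k) (x i)) = p then 1 else 0) := by
    rw [discretize, lp.coeFn_sum, Finset.sum_apply]
    rfl
  rw [this]
  simp [hmem]

lemma tendsto_discretize {z : LInf (Cube ι)} (hz : Continuous fun x => z x) :
    Tendsto (fun k => discretize k z) atTop (𝓝 z) := by
  rw [Metric.tendsto_atTop]
  intro ε hε
  have huc := CompactSpace.uniformContinuous_of_continuous hz
  obtain ⟨δ, hδ, h⟩ := Metric.uniformContinuous_iff.1 huc (ε / 2) (half_pos hε)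
  obtain ⟨N, hN⟩ := exists_nat_one_div_lt hδ
  refine ⟨N, fun k hk => ?_⟩
  rw [dist_eq_norm]
  refine lt_of_le_of_lt (lp.norm_le_of_forall_le (half_pos hε).le fun x => ?_) (half_lt_self hε)
  rw [lp.coeFn_sub, Pi.sub_apply, discretize_apply, ← dist_eq_norm]
  refine (h ?_).le
  rw [dist_pi_lt_iff hδ]
  intro i
  rw [Subtype.dist_eq, Real.dist_eq,
    abs_of_nonneg (sub_nonneg.2 (show (x i : ℝ) ≤ _ from le_roundUp (uniformGrid k) (x i)))]
  have h1 := roundUp_uniformGrid_le k (x i)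
  have h2 : (1 : ℝ) / (k + 1) ≤ 1 / (N + 1) := Nat.one_div_le_one_div hk
  linarith

/-- A continuous linear image of a Gaussian law with continuous sample paths is Gaussian: on
continuous paths the operator is a limit of finite linear combinations of point evaluations. -/
lemma IsGaussianLaw.map {L : Measure (LInf (Cube ι))} [IsProbabilityMeasure L]
    (hL : IsGaussianLaw L) (hc : ∀ᵐ z ∂L, Continuous fun x => z x) {S : Type*}
    (Φ : LInf (Cube ι) →L[ℝ] LInf S) : IsGaussianLaw (L.map Φ) := by
  have heval : ∀ s : S, Continuous fun z : LInf S => z s := fun s =>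
    (lp.evalCLM ℝ (fun _ : S => ℝ) ∞ s).continuous
  have hproc : IsGaussianProcess (fun (s : S) z => Φ z s) L := by
    refine isGaussianProcess_of_ae_tendsto (X := fun k s z => Φ (discretize k z) s) (fun k => ?_)
      fun s => ?_
    · refine hL.of_isGaussianProcess fun s =>
        ⟨Fintype.piFinset fun _ => insert 1 (uniformGrid k), ∑ p, Φ (cellIndicator k p.1) s •
          ContinuousLinearMap.proj p, fun z => ?_⟩
      rw [discretize, map_sum, lp.coeFn_sum, Finset.sum_apply, ← Finset.sum_coe_sort]
      simp [mul_comm]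
    · filter_upwards [hc] with z hz
      exact (((heval s).comp Φ.continuous).tendsto z).comp (tendsto_discretize hz)
  refine ⟨fun I => ⟨?_⟩⟩
  rw [Measure.map_map _ Φ.continuous.measurable]
  · exact (hproc.hasGaussianLaw I).isGaussian_map
  · exact measurable_pi_lambda _ fun s => (heval s).measurable

/-- A law with continuous sample paths is tight, since the continuous functions on the cube form
a Polish space. -/
lemma isTightMeasureSet_of_ae_continuous {ι : Type*} [Fintype ι] {L : Measure (LInf (Cube ι))} [IsProbabilityMeasure L]
    (hc : ∀ᵐ z ∂L, Continuous fun x => z x) : IsTightMeasureSet {L} := by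
  let J : C(Cube ι, ℝ) → LInf (Cube ι) := fun φ =>
    ⟨fun x => φ x, memℓp_infty ⟨‖φ‖, by rintro _ ⟨x, rfl⟩; exact φ.norm_coe_le_norm x⟩⟩
  have hJ : Isometry J := by
    refine Isometry.of_dist_eq fun φ ψ => le_antisymm ?_ ?_
    · rw [dist_eq_norm]
      refine lp.norm_le_of_forall_le dist_nonneg fun x => ?_
      exact (dist_eq_norm (φ x) (ψ x)).symm.trans_le (ContinuousMap.dist_apply_le_dist x)
    · rw [ContinuousMap.dist_le dist_nonneg]
      intro x
      rw [dist_eq_norm, dist_eq_norm]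
      exact lp.norm_apply_le_norm ENNReal.top_ne_zero (J φ - J ψ) x
  borelize C(Cube ι, ℝ)
  have hemb := hJ.isClosedEmbedding.measurableEmbedding
  have hmap : (L.comap J).map J = L := by
    rw [hemb.map_comap]
    refine Measure.restrict_eq_self_of_ae_mem ?_
    filter_upwards [hc] with z hz
    exact ⟨⟨_, hz⟩, rfl⟩
  have hfin : IsFiniteMeasure (L.comap J) := by
    refine ⟨?_⟩
    rw [hemb.comap_apply]
    exact measure_lt_top _ _
  rw [← hmap, ← Set.image_singleton]
  exact isTightMeasureSet_singleton.map hJ.continuous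

end Image

/-! ### Continuous mapping -/

section Mapping

/-- The outer expectation of bounded functions only depends on their almost everywhere class,
even without measurability. -/
lemma outerExpectation_congr {Ω : Type*} [MeasurableSpace Ω] {P : Measure Ω} {X Y : Ω → ℝ} {B : ℝ}
    (h : X =ᵐ[P] Y) (hX : ∀ ω, X ω ≤ B) (hY : ∀ ω, Y ω ≤ B) :
    outerExpectation P X = outerExpectation P Y := by
  have key : ∀ {X Y : Ω → ℝ}, X =ᵐ[P] Y → (∀ ω, Y ω ≤ B) → ∀ r : ℝ,
      (∃ U : Ω → ℝ, Measurable U ∧ Integrable U P ∧ (∀ ω, X ω ≤ U ω) ∧ r = ∫ ω, U ω ∂P) →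
      ∃ U : Ω → ℝ, Measurable U ∧ Integrable U P ∧ (∀ ω, Y ω ≤ U ω) ∧ r = ∫ ω, U ω ∂P := by
    classical
    rintro X Y h hY r ⟨U, hU, hUi, hXU, rfl⟩
    -- The majorant is raised to the common bound `B` on a measurable null set.
    set N := toMeasurable P {ω | X ω = Y ω}ᶜ with hN
    have hN0 : P N = 0 := by rw [hN, measure_toMeasurable]; exact h
    have hae : N.piecewise (fun _ => B) U =ᵐ[P] U := by
      filter_upwards [measure_eq_zero_iff_ae_notMem.1 hN0] with ω hω
      exact Set.piecewise_eq_of_notMem _ _ _ hω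
    refine ⟨_, measurable_const.piecewise (measurableSet_toMeasurable _ _) hU,
      hUi.congr hae.symm, fun ω => ?_, (integral_congr_ae hae).symm⟩
    by_cases hω : ω ∈ N
    · rw [Set.piecewise_eq_of_mem _ _ _ hω]; exact hY ω
    · rw [Set.piecewise_eq_of_notMem _ _ _ hω]
      have hXY : X ω = Y ω := by
        by_contra hne
        exact hω (subset_toMeasurable P _ hne)
      exact hXY ▸ hXU ω
  unfold outerExpectation
  congr 1
  ext r
  exact ⟨key h hY r, key h.symm hX r⟩

lemma toLInf_apply {S : Type*} {g : S → ℝ} (hg : Memℓp g ∞) (s : S) : toLInf g s = g s := by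
  rw [toLInf, dif_pos hg]

lemma toLInf_coe {S : Type*} (z : LInf S) : toLInf (fun s => z s) = z := by
  rw [toLInf, dif_pos (lp.memℓp z)]

/-- The continuous mapping theorem for processes that almost surely are images of weakly
convergent ones. -/
lemma ConvergesWeakly.map {Ω : ℕ → Type*} [∀ n, MeasurableSpace (Ω n)] {P : ∀ n, Measure (Ω n)}
    {S S' : Type*} {X : ∀ n, Ω n → S → ℝ} {X' : ∀ n, Ω n → S' → ℝ} {L : Measure (LInf S)}
    (h : ConvergesWeakly P X L) {Φ : LInf S → LInf S'} (hΦ : Continuous Φ)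
    (hX : ∀ n, ∀ᵐ ω ∂P n, X' n ω = fun s => Φ (toLInf (X n ω)) s) :
    ConvergesWeakly P X' (L.map Φ) where
  bounded n := by
    filter_upwards [hX n] with ω hω
    rw [hω]
    exact lp.memℓp _
  tendsto H := by
    rw [integral_map hΦ.aemeasurable H.continuous.aestronglyMeasurable]
    refine (h.tendsto (H.compContinuous ⟨Φ, hΦ⟩)).congr fun n => ?_
    refine outerExpectation_congr (B := ‖H‖) ?_ (fun ω => ?_) fun ω => ?_
    · filter_upwards [hX n] with ω hω
      rw [hω, toLInf_coe]
      rfl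
    · exact (le_abs_self _).trans (H.norm_coe_le_norm _)
    · exact (le_abs_self _).trans (H.norm_coe_le_norm _)

end Mapping

end HardyKrause

end

open HardyKrause
theorem theorem1 (d : ℕ)
    {Ω : ℕ → Type*} [∀ n, MeasurableSpace (Ω n)]
    (P : ∀ n, Measure (Ω n)) [∀ n, IsProbabilityMeasure (P n)]
    (G : ∀ n, Ω n → Cube (Fin d) → ℝ)
    (hG : ∀ n, ∀ᵐ ω ∂P n, IsRCBoundedHK (G n ω))
    (hG_zero : ∀ n, ∀ u : Cube (Fin d), (∃ j, u j = 0) → ∀ᵐ ω ∂P n, G n ω u = 0)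
    (L : Measure (LInf (Cube (Fin d)))) [IsProbabilityMeasure L]
    (hL_gaussian : IsGaussianLaw L)
    (hL_continuous : ∀ᵐ z ∂L, Continuous (fun u : Cube (Fin d) => z u))
    (hconv : ConvergesWeakly P G L)
    (T : ℝ≥0) (F : Set (Cube (Fin d) → ℝ))
    (hF : ∀ f ∈ F, IsRCBoundedHK f ∧ hardyKrauseVariation f ≤ (T : ℝ≥0∞)) :
    (∀ n, ∀ᵐ ω ∂P n, IsMeasureOf (G n ω) (measureOf (G n ω)) ∧
      ∀ f ∈ F, (measureOf (G n ω)).Integrable f) ∧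
    ∃ L' : Measure (LInf F), IsProbabilityMeasure L' ∧ IsTightMeasureSet {L'} ∧
      IsGaussianLaw L' ∧
      ConvergesWeakly P (fun n ω (f : F) => stieltjesIntegral (f : Cube (Fin d) → ℝ) (G n ω)) L' := by
  obtain ⟨Φ, hΦ⟩ := exists_integration_operator T F hF
  refine ⟨fun n => ?_, L.map Φ, Measure.isProbabilityMeasure_map Φ.continuous.aemeasurable, ?_,
    hL_gaussian.map hL_continuous Φ, hconv.map Φ.continuous fun n => ?_⟩
  · filter_upwards [hG n] with ω hω
    exact ⟨isMeasureOf_measureOf hω.exists_isMeasureOf, fun f hf => (hF f hf).1.integrable _⟩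
  · rw [← Set.image_singleton]
    exact (isTightMeasureSet_of_ae_continuous hL_continuous).map Φ.continuous
  · filter_upwards [hG n] with ω hω
    obtain ⟨ν, hν⟩ := hω.exists_isMeasureOf
    obtain ⟨B, hB⟩ := hω.exists_abs_le
    have hmem : Memℓp (G n ω) ∞ := memℓp_infty ⟨B, by rintro _ ⟨x, rfl⟩; exact hB x⟩
    have hcoe : (fun x => toLInf (G n ω) x) = G n ω := funext (toLInf_apply hmem)
    funext f
    rw [hΦ _ ⟨ν, hcoe.symm ▸ hν⟩ f, hcoe]
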